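/- For a finite simple graph $G$ with vertex set $V$, minimum degree $\delta(G)$ and order $|G|$, let $\mu(G)=\delta(G)/(|G|-1)$ be its strong density (with the convention $\mu(G)=0$ if $|G|=1$). The homogeneous Kuramoto model on $G$ is the system $$\dot\theta_v=\sum_{u\sim v}\sin(\theta_u-\theta_v),\qquad v\in V .$$ It is the gradient system $\dot\theta=-\nabla U$ of $U(\theta)=\sum_{uv\in E}(1-\cos(\theta_u-\theta_v))$. A point $\theta\in\mathbb R^V$ is an equilibrium if all right-hand sides vanish; it is a consensus if all $\theta_v$ are equal modulo $2\pi$; an equilibrium is linearly stable if all eigenvalues of the Hessian $U''_\theta$ on the hyperplane orthogonal to $(1,\dots,1)$ are positive. $G$ synchronizes if for Lebesgue-almost every initial condition in $\mathbb R^V$ the orbit converges, modulo $2\pi$, to some $(c,\dots,c)$. The critical connectivity $\mu_c$ is the infimum of all real $\mu$ such that every finite simple graph $G$ (with at least one vertex) with $\mu(G)>\mu$ synchronizes. For non-negative integers $p=(a,b,c,d)$ let $G_p$ be the weighted graph on $\mathbb Z_8$ whose edges are $(2i)(2i+1)$ with weight $a$, $(2i+1)(2i+2)$ with weight $c$, $(2i)(2i+5)$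 with weight $d$ (each for $i=0,1,2,3$), and $i(i+2)$ with weight $b$ (for $i\in\mathbb Z_8$). For a weighted graph $G$ with weights $w_{uv}\le k$, each edge being written with its endpoints in a fixed order, the $k$-spinning $S_k(G)$ is the simple graph on $V\times\mathbb Z_k$ in which $(u,i)(u,j)$ is an edge for all $u$ and $i\ne j$, and, for every edge written $uv$, $(u,i)(v,j)$ is an edge whenever $j\in i+\{0,1,\dots,w_{uv}-1\}$. The edges of $G_p$ are written in the order displayed above. Theorem. The critical connectivity satisfies $\mu_c\ge 11/16$. Moreover, for every integer $k\ge1$, with $p_k=(k,k,k,\lceil k/2\rceil-1)$, the graph $S_k(G_{p_k})$ has $8k$ vertices, is regular of degree $5k+\lceil k/2\rceil-2$, has a linearly stable equilibrium that is not a consensus, and does not synchronize; and $\mu(S_k(G_{p_k}))\to 11/16$ as $k\to\infty$. -/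

import Mathlib

open Filter Topology MeasureTheory

noncomputable section

/-! ### The homogeneous Kuramoto model on a finite simple graph -/

/-- The strong density `δ(G) / (|G| - 1)`. -/
def strongDensity {V : Type*} [Fintype V] (G : SimpleGraph V) [DecidableRel G.Adj] : ℝ :=
  (G.minDegree : ℝ) / ((Fintype.card V : ℝ) - 1)

/-- The right-hand side `∑_{u ∼ v} sin (θ_u - θ_v)` of the Kuramoto system. -/
def kuramotoField {V : Type*} [Fintype V] (G : SimpleGraph V) [DecidableRel G.Adj]
    (θ : V → ℝ) : V → ℝ :=
  fun v => ∑ u ∈ G.neighborFinset v, Real.sin (θ u - θ v)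

/-- `θ` is a solution, defined for all times, of `θ' = kuramotoField G θ`. -/
def IsKuramotoSolution {V : Type*} [Fintype V] (G : SimpleGraph V) [DecidableRel G.Adj]
    (θ : ℝ → V → ℝ) : Prop :=
  ∀ t : ℝ, HasDerivAt θ (kuramotoField G (θ t)) t

def IsKuramotoEquilibrium {V : Type*} [Fintype V] (G : SimpleGraph V) [DecidableRel G.Adj]
    (θ : V → ℝ) : Prop :=
  ∀ v, ∑ u ∈ G.neighborFinset v, Real.sin (θ u - θ v) = 0

/-- All phases agree as points of the circle `ℝ / 2πℤ`. -/
def IsConsensus {V : Type*} (θ : V → ℝ) : Prop :=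
  ∃ c : Real.Angle, ∀ v, (θ v : Real.Angle) = c

/-- The orbit converges, on the torus `(ℝ / 2πℤ)^V`, to a consensus `(c, …, c)`. -/
def TendsToConsensus {V : Type*} (θ : ℝ → V → ℝ) : Prop :=
  ∃ c : Real.Angle, ∀ v, Tendsto (fun t => (θ t v : Real.Angle)) atTop (𝓝 c)

/-- Almost every initial condition (for Lebesgue measure) lies on an orbit that tends to a
consensus. The vector field is globally Lipschitz, so exactly one orbit starts at each point. -/
def Synchronizes {V : Type*} [Fintype V] (G : SimpleGraph V) [DecidableRel G.Adj] : Prop :=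
  ∀ᵐ x : V → ℝ ∂volume,
    ∃ θ : ℝ → V → ℝ, IsKuramotoSolution G θ ∧ θ 0 = x ∧ TendsToConsensus θ

/-- The critical connectivity `μ_c`: the least `μ` such that every finite simple graph with
strong density greater than `μ` synchronizes. -/
def criticalConnectivity : ℝ :=
  sInf {μ : ℝ | ∀ (V : Type) [Fintype V] [Nonempty V] (G : SimpleGraph V) [DecidableRel G.Adj],
    μ < strongDensity G → Synchronizes G}

/-- The potential energy `∑_{uv ∈ E} (1 - cos (θ_u - θ_v))`, as half the sum over ordered pairs. -/
def kuramotoPotential {V : Type*} [Fintype V] (G : SimpleGraph V) [DecidableRel G.Adj]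
    (θ : V → ℝ) : ℝ :=
  (1 / 2) * ∑ v, ∑ u ∈ G.neighborFinset v, (1 - Real.cos (θ u - θ v))

open Classical in
/-- The Hessian matrix of the potential energy at `θ`. -/
def kuramotoHessian {V : Type*} [Fintype V] (G : SimpleGraph V) [DecidableRel G.Adj]
    (θ : V → ℝ) : Matrix V V ℝ :=
  fun u v =>
    if u = v then ∑ z ∈ G.neighborFinset u, Real.cos (θ u - θ z)
    else if G.Adj u v then -Real.cos (θ u - θ v)
    else 0

/-- The Kuramoto system is the gradient system `θ' = -∇U` of the potential energy `U`. -/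
theorem hasFDerivAt_kuramotoPotential {V : Type*} [Fintype V] (G : SimpleGraph V)
    [DecidableRel G.Adj] (θ : V → ℝ) :
    HasFDerivAt (kuramotoPotential G)
      (-∑ v, kuramotoField G θ v • ContinuousLinearMap.proj (R := ℝ) (φ := fun _ : V => ℝ) v)
      θ := by
  have h : ∀ v u : V, HasFDerivAt (fun θ : V → ℝ => 1 - Real.cos (θ u - θ v))
      (Real.sin (θ u - θ v) • (ContinuousLinearMap.proj (R := ℝ) (φ := fun _ : V => ℝ) u -
        ContinuousLinearMap.proj (R := ℝ) (φ := fun _ : V => ℝ) v)) θ := by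
    intro v u
    have h1 := ((hasFDerivAt_apply (𝕜 := ℝ) u θ).sub (hasFDerivAt_apply (𝕜 := ℝ) v θ)).cos
    refine (h1.const_sub 1).congr_fderiv ?_
    refine ContinuousLinearMap.ext fun x => ?_
    change -(-Real.sin (θ u - θ v) * (x u - x v)) = Real.sin (θ u - θ v) * (x u - x v)
    ring
  have h2 := (HasFDerivAt.fun_sum (u := Finset.univ) fun v _ =>
    HasFDerivAt.fun_sum (u := G.neighborFinset v) fun u _ => h v u).const_mul (1 / 2)
  refine h2.congr_fderiv ?_
  refine ContinuousLinearMap.ext fun x => ?_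
  simp only [SimpleGraph.neighborFinset_eq_filter, Finset.sum_filter, kuramotoField,
    smul_apply, sum_apply, neg_apply,
    smul_eq_mul, sub_apply, ContinuousLinearMap.proj_apply, Finset.sum_mul,
    apply_ite (fun L : (V → ℝ) →L[ℝ] ℝ => L x), zero_apply]
  have h3 : ∑ v, ∑ u, (if G.Adj v u then Real.sin (θ u - θ v) * x u else 0) =
      -∑ v, ∑ u, (if G.Adj v u then Real.sin (θ u - θ v) * x v else 0) := by
    rw [Finset.sum_comm, ← Finset.sum_neg_distrib]
    refine Finset.sum_congr rfl fun v _ => ?_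
    rw [← Finset.sum_neg_distrib]
    refine Finset.sum_congr rfl fun u _ => ?_
    rw [← neg_sub (θ u), Real.sin_neg]
    by_cases huv : G.Adj v u
    · rw [if_pos huv, if_pos huv.symm]
      ring
    · rw [if_neg huv, if_neg fun h => huv h.symm, neg_zero]
  have h4 : ∑ v, ∑ u, (if G.Adj v u then Real.sin (θ u - θ v) * (x u - x v) else 0) =
      ∑ v, ∑ u, (if G.Adj v u then Real.sin (θ u - θ v) * x u else 0) -
      ∑ v, ∑ u, (if G.Adj v u then Real.sin (θ u - θ v) * x v else 0) := by
    simp only [← Finset.sum_sub_distrib]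
    refine Finset.sum_congr rfl fun v _ => Finset.sum_congr rfl fun u _ => ?_
    split_ifs <;> ring
  simp only [ite_mul, zero_mul]
  rw [h4, h3]
  ring

/-- The Jacobian matrix of the vector field `-∇U` is minus the Hessian matrix. -/
theorem hasFDerivAt_kuramotoField {V : Type*} [Fintype V] (G : SimpleGraph V)
    [DecidableRel G.Adj] (θ : V → ℝ) :
    HasFDerivAt (kuramotoField G)
      (-(kuramotoHessian G θ).mulVecLin.toContinuousLinearMap) θ := by
  rw [hasFDerivAt_pi']
  intro v
  have h2 := HasFDerivAt.fun_sum (u := G.neighborFinset v) fun u _ =>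
    ((hasFDerivAt_apply (𝕜 := ℝ) u θ).sub (hasFDerivAt_apply (𝕜 := ℝ) v θ)).sin
  refine h2.congr_fderiv ?_
  refine ContinuousLinearMap.ext fun x => ?_
  classical
  have h3 : (kuramotoHessian G θ).mulVec x v =
      ∑ u, if G.Adj v u then Real.cos (θ v - θ u) * (x v - x u) else 0 := by
    have h4 : ∀ u, kuramotoHessian G θ v u * x u =
        (if u = v then (∑ z ∈ G.neighborFinset v, Real.cos (θ v - θ z)) * x v else 0) +
        (if G.Adj v u then -Real.cos (θ v - θ u) * x u else 0) := by
      intro u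
      unfold kuramotoHessian
      by_cases huv : v = u
      · subst huv
        simp
      · rw [if_neg huv, if_neg (Ne.symm huv)]
        split_ifs <;> ring
    simp only [Matrix.mulVec, dotProduct, h4, Finset.sum_add_distrib, Finset.sum_ite_eq',
      Finset.mem_univ, if_true, SimpleGraph.neighborFinset_eq_filter, Finset.sum_filter,
      Finset.sum_mul, ite_mul, zero_mul]
    rw [← Finset.sum_add_distrib]
    refine Finset.sum_congr rfl fun u _ => ?_
    split_ifs <;> ring
  change _ = -((kuramotoHessian G θ).mulVec x v)
  rw [h3, sum_apply, SimpleGraph.neighborFinset_eq_filter, Finset.sum_filter,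
    ← Finset.sum_neg_distrib]
  refine Finset.sum_congr rfl fun u _ => ?_
  split_ifs
  · change Real.cos (θ u - θ v) * (x u - x v) = _
    rw [← neg_sub (θ v), Real.cos_neg]
    ring
  · simp

/-- An equilibrium at which every eigenvalue of the Hessian on the hyperplane orthogonal to
`(1, …, 1)` is positive. -/
def IsLinearlyStableEquilibrium {V : Type*} [Fintype V] (G : SimpleGraph V)
    [DecidableRel G.Adj] (θ : V → ℝ) : Prop :=
  IsKuramotoEquilibrium G θ ∧
    ∀ (l : ℝ) (x : V → ℝ), x ≠ 0 → ∑ v, x v = 0 →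
      (kuramotoHessian G θ).mulVec x = l • x → 0 < l

/-! ### Weighted graphs and their spinnings -/

/-- A simple graph with natural number weights on its edges (the values of `weight` off the
edge set play no role), each edge being written in a definite order of its two endpoints:
`arc u v` says that the edge is written `uv`. -/
structure WeightedGraph (V : Type*) where
  graph : SimpleGraph V
  weight : Sym2 V → ℕ
  arc : V → V → Prop
  arc_or : ∀ u v, graph.Adj u v ↔ arc u v ∨ arc v u
  arc_asymm : ∀ u v, arc u v → ¬ arc v u

/-- The `k`-spinning: vertex set `V × ℤ_k`; all edges inside each fibre, and, for every edge
written `uv`, the edges `(u,i)(v,j)` with `j ∈ i + {0, …, w_{uv} - 1}`. -/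
def spinning {V : Type*} (G : WeightedGraph V) (k : ℕ) : SimpleGraph (V × ZMod k) :=
  SimpleGraph.fromRel fun x y =>
    (x.1 = y.1 ∧ x.2 ≠ y.2) ∨
      (G.arc x.1 y.1 ∧ ∃ h : ℕ, h < G.weight s(x.1, y.1) ∧ y.2 = x.2 + (h : ZMod k))

instance spinningDecidableRel {V : Type*} (G : WeightedGraph V) (k : ℕ) :
    DecidableRel (spinning G k).Adj := Classical.decRel _

/-! ### The weighted graphs `G_p` on `ℤ_8` -/

/-- `E_a`: the pairs `(2i)(2i+1)`. -/
def arcA (u v : ZMod 8) : Prop := ∃ i : Fin 4, u = 2 * (i : ℕ) ∧ v = 2 * (i : ℕ) + 1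

/-- `E_b`: the pairs `i(i+2)`. -/
def arcB (u v : ZMod 8) : Prop := v = u + 2

/-- `E_c`: the pairs `(2i+1)(2i+2)`. -/
def arcC (u v : ZMod 8) : Prop := ∃ i : Fin 4, u = 2 * (i : ℕ) + 1 ∧ v = 2 * (i : ℕ) + 2

/-- `E_d`: the pairs `(2i)(2i+5)`. -/
def arcD (u v : ZMod 8) : Prop := ∃ i : Fin 4, u = 2 * (i : ℕ) ∧ v = 2 * (i : ℕ) + 5

instance arcADecidable : DecidableRel arcA := fun u v => by unfold arcA; infer_instance
instance arcBDecidable : DecidableRel arcB := fun u v => by unfold arcB; infer_instance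
instance arcCDecidable : DecidableRel arcC := fun u v => by unfold arcC; infer_instance
instance arcDDecidable : DecidableRel arcD := fun u v => by unfold arcD; infer_instance

/-- `G_p` for `p = (a, b, c, d)`; edges of `E_t` have weight `t`. -/
def weightedG (a b c d : ℕ) : WeightedGraph (ZMod 8) where
  graph := SimpleGraph.fromRel fun u v => arcA u v ∨ arcB u v ∨ arcC u v ∨ arcD u v
  weight := Sym2.lift ⟨fun u v =>
    if arcA u v ∨ arcA v u then a
    else if arcB u v ∨ arcB v u then b
    else if arcC u v ∨ arcC v u then c
    else if arcD u v ∨ arcD v u then d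
    else 0, fun u v => by simp only [or_comm]⟩
  arc := fun u v => arcA u v ∨ arcB u v ∨ arcC u v ∨ arcD u v
  arc_or := by
    intro u v
    rw [SimpleGraph.fromRel_adj]
    revert u v
    decide
  arc_asymm := by decide

/-- `S_k(G_{p_k})` with `p_k = (k, k, k, ⌈k/2⌉ - 1)`. -/
abbrev spinG (k : ℕ) : SimpleGraph (ZMod 8 × ZMod k) :=
  spinning (weightedG k k k (⌈(k : ℝ) / 2⌉₊ - 1)) k

end

/-!
A linearly stable equilibrium is, transversally to `(1, …, 1)`, a strict local minimum of the
potential energy, which decreases along orbits; hence orbits starting close to it stay close to it.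
If it is not a consensus, then an open set of initial conditions fails to reach a consensus.

Phases on `V` that are in equilibrium for the number of edges between fibres of a spinning lift to
an equilibrium of the spinning. Its Hessian splits along the fibre means of a perturbation, where it
is the Hessian of the quotient, and the deviations from these means, where the complete fibres
outweigh the edges with negative cosine as long as these have total weight less than `k / 2` at
every vertex.

On `G_p` let the phase grow by `π / 2` with every step `u ↦ u + 2` and by `φ` from `2i` to `2i + 1`,
where `tan φ = c / (a - d)`. The edges of weight `b` join phases at right angles and drop out of the
Hessian, which becomes the form of an octagon with four chords of negative weight. It is positive
when `d < a` and `2ad < c²`. For `p_k` both this and the condition on the fibres say `2d < k`, and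
the density tends to `(5 + 1 / 2) / 8 = 11 / 16`.
-/

section LyapunovStability

lemma isCoercive_of_forall_pos {E : Type*} [NormedAddCommGroup E] [NormedSpace ℝ E]
    [FiniteDimensional ℝ E] {B : E →L[ℝ] E →L[ℝ] ℝ} (hB : ∀ x ≠ 0, 0 < B x x) :
    IsCoercive B := by
  have : ProperSpace E := FiniteDimensional.proper_real E
  obtain ⟨C, hC, hCB⟩ : ∃ C, 0 < C ∧ ∀ x ∈ Metric.sphere (0 : E) 1, C ≤ B x x :=
    (isCompact_sphere 0 1).exists_forall_le' (by fun_prop)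
      fun x hx => hB x (ne_zero_of_mem_unit_sphere ⟨x, hx⟩)
  refine ⟨C, hC, fun x => ?_⟩
  obtain rfl | hx := eq_or_ne x 0
  · simp
  have hnorm : 0 < ‖x‖ := norm_pos_iff.2 hx
  have hunit := hCB (‖x‖⁻¹ • x) (by simp [norm_smul, hnorm.ne'])
  simp only [map_smul, smul_apply, smul_eq_mul] at hunit
  field_simp at hunit
  linarith

lemma eventually_lt_of_isCoercive_hessian {E : Type*} [NormedAddCommGroup E] [NormedSpace ℝ E]
    {f : E → ℝ} {f' : E → E →L[ℝ] ℝ} {B : E →L[ℝ] E →L[ℝ] ℝ} {a : E}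
    (hf : ∀ᶠ x in 𝓝 a, HasFDerivAt f (f' x) x) (ha : f' a = 0) (hf' : HasFDerivAt f' B a)
    (hB : IsCoercive B) : ∀ᶠ x in 𝓝[≠] a, f a < f x := by
  obtain ⟨C, hC, hBC⟩ := hB
  obtain ⟨r, hr, hball⟩ := Metric.eventually_nhds_iff_ball.1
    (hf.and (hf'.isLittleO.def (half_pos hC)))
  refine eventually_nhdsWithin_iff.2 (Metric.eventually_nhds_iff_ball.2 ⟨r, hr, fun x hx hxa => ?_⟩)
  have hxa' : 0 < ‖x - a‖ := norm_pos_iff.2 (sub_ne_zero.2 hxa)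
  have hmem : ∀ t ∈ Set.Icc (0 : ℝ) 1, a + t • (x - a) ∈ Metric.ball a r := fun t ht =>
    (convex_ball a r).add_smul_sub_mem (Metric.mem_ball_self hr) hx ht
  have hray : ∀ t ∈ Set.Icc (0 : ℝ) 1, HasDerivAt (fun t : ℝ => f (a + t • (x - a)))
      (f' (a + t • (x - a)) (x - a)) t := fun t ht =>
    (hball _ (hmem t ht)).1.comp_hasDerivAt t
      (by simpa using ((hasDerivAt_id t).smul_const (x - a)).const_add a)
  obtain ⟨t, ht, hslope⟩ := exists_hasDerivAt_eq_slope _ _ one_pos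
    (fun t ht => (hray t ht).continuousAt.continuousWithinAt)
    fun t ht => hray t (Set.Ioo_subset_Icc_self ht)
  have hlinear := (hball _ (hmem t (Set.Ioo_subset_Icc_self ht))).2
  rw [ha, sub_zero, add_sub_cancel_left, norm_smul, Real.norm_of_nonneg ht.1.le] at hlinear
  have hremainder : |f' (a + t • (x - a)) (x - a) - t * B (x - a) (x - a)|
      ≤ C / 2 * (t * ‖x - a‖) * ‖x - a‖ := by
    simpa using ContinuousLinearMap.le_of_opNorm_le _ hlinear (x - a)
  have hquadratic := mul_le_mul_of_nonneg_left (hBC (x - a)) ht.1.le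
  have hpos : 0 < t * (C * ‖x - a‖ * ‖x - a‖) := mul_pos ht.1 (by positivity)
  simp only [one_smul, zero_smul, add_sub_cancel, add_zero, sub_zero, div_one] at hslope
  linarith [neg_abs_le (f' (a + t • (x - a)) (x - a) - t * B (x - a) (x - a))]

lemma eventually_forall_dist_lt_of_antitoneOn {X : Type*} [PseudoMetricSpace X] [ProperSpace X]
    {L : X → ℝ} {a : X} (hL : Continuous L) (hmin : ∀ᶠ x in 𝓝[≠] a, L a < L x) {ε : ℝ}
    (hε : 0 < ε) :
    ∀ᶠ x in 𝓝 a, ∀ γ : ℝ → X, Continuous γ → γ 0 = x → AntitoneOn (L ∘ γ) (Set.Ici 0) →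
      ∀ t ≥ 0, dist (γ t) a < ε := by
  obtain ⟨r, hr, hball⟩ := Metric.eventually_nhds_iff_ball.1 (eventually_nhdsWithin_iff.1 hmin)
  obtain ⟨δ, hδ, hδr⟩ := exists_between (lt_min hr hε)
  obtain ⟨hδr, hδε⟩ := lt_min_iff.1 hδr
  obtain ⟨m, hm, hsphere⟩ := (isCompact_sphere a δ).exists_forall_le' hL.continuousOn fun x hx =>
    hball x (Metric.sphere_subset_ball hδr hx) (Metric.ne_of_mem_sphere hx hδ.ne')
  filter_upwards [hL.continuousAt.eventually_lt_const hm, Metric.ball_mem_nhds a hδ]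
    with x hxm hxδ γ hγ hγ0 hanti t ht
  subst hγ0
  by_contra! hfar
  obtain ⟨s, hs, hsδ⟩ := intermediate_value_Icc ht (f := fun s => dist (γ s) a) (by fun_prop)
    ⟨(Metric.mem_ball.1 hxδ).le, hδε.le.trans hfar⟩
  exact ((hsphere (γ s) hsδ).trans (hanti Set.self_mem_Ici hs.1 hs.1)).not_gt hxm

end LyapunovStability

section Kuramoto

lemma TendsToConsensus.tendsto_cos_sub {V : Type*} {γ : ℝ → V → ℝ} (h : TendsToConsensus γ)
    (u v : V) : Tendsto (fun t => Real.cos (γ t u - γ t v)) atTop (𝓝 1) := by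
  obtain ⟨c, hc⟩ := h
  have hcos := (Real.Angle.continuous_cos.tendsto _).comp ((hc u).sub (hc v))
  simpa only [sub_self, Real.Angle.cos_zero, Function.comp_def, ← Real.Angle.coe_sub,
    Real.Angle.cos_coe] using hcos

lemma exists_cos_sub_lt_one_of_not_isConsensus {V : Type*} {θ : V → ℝ}
    (h : ¬ IsConsensus θ) : ∃ u v, Real.cos (θ u - θ v) < 1 := by
  contrapose! h
  obtain _ | ⟨⟨w⟩⟩ := isEmpty_or_nonempty V
  · exact ⟨0, isEmptyElim⟩
  refine ⟨θ w, fun v => ?_⟩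
  obtain ⟨n, hn⟩ := (Real.cos_eq_one_iff _).1 ((Real.cos_le_one _).antisymm (h v w))
  exact Real.Angle.angle_eq_iff_two_pi_dvd_sub.2 ⟨n, by linarith⟩

variable {V : Type*} [Fintype V] {G : SimpleGraph V} [DecidableRel G.Adj] {θ : V → ℝ}

lemma sum_neighborFinset_comm {M : Type*} [AddCommMonoid M] (G : SimpleGraph V)
    [DecidableRel G.Adj] (F : V → V → M) :
    ∑ v, ∑ u ∈ G.neighborFinset v, F v u = ∑ v, ∑ u ∈ G.neighborFinset v, F u v := by
  simp only [SimpleGraph.neighborFinset_eq_filter, Finset.sum_filter]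
  rw [Finset.sum_comm]
  simp only [G.adj_comm]

lemma sum_neighborFinset_eq_zero {M : Type*} [AddCommGroup M] [IsAddTorsionFree M]
    (G : SimpleGraph V) [DecidableRel G.Adj] {F : V → V → M} (hF : ∀ u v, F u v = -F v u) :
    ∑ v, ∑ u ∈ G.neighborFinset v, F v u = 0 := by
  refine self_eq_neg.1 ?_
  conv_lhs => rw [sum_neighborFinset_comm]
  simp only [← Finset.sum_neg_distrib, ← hF]

lemma sum_kuramotoField (G : SimpleGraph V) [DecidableRel G.Adj] (θ : V → ℝ) :
    ∑ v, kuramotoField G θ v = 0 :=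
  sum_neighborFinset_eq_zero G fun u v => by rw [← neg_sub, Real.sin_neg]

lemma kuramotoHessian_mulVec (G : SimpleGraph V) [DecidableRel G.Adj] (θ x : V → ℝ) (v : V) :
    (kuramotoHessian G θ).mulVec x v =
      ∑ u ∈ G.neighborFinset v, Real.cos (θ v - θ u) * (x v - x u) := by
  classical
  have hentry : ∀ u, kuramotoHessian G θ v u * x u =
      (if u = v then (∑ z ∈ G.neighborFinset v, Real.cos (θ v - θ z)) * x v else 0) -
        (if G.Adj v u then Real.cos (θ v - θ u) * x u else 0) := by
    intro u
    obtain rfl | huv := eq_or_ne v u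
    · simp [kuramotoHessian]
    · simp only [kuramotoHessian, if_neg huv, if_neg huv.symm]
      split_ifs <;> ring
  simp only [Matrix.mulVec, dotProduct, hentry, Finset.sum_sub_distrib, Finset.sum_ite_eq',
    Finset.mem_univ, if_true, ← Finset.sum_filter, ← SimpleGraph.neighborFinset_eq_filter,
    Finset.sum_mul, mul_sub]

lemma sum_kuramotoHessian_mulVec (G : SimpleGraph V) [DecidableRel G.Adj] (θ x : V → ℝ) :
    ∑ v, (kuramotoHessian G θ).mulVec x v = 0 := by
  simp only [kuramotoHessian_mulVec]
  exact sum_neighborFinset_eq_zero G fun u v => by rw [← neg_sub, Real.cos_neg]; ring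

lemma kuramotoHessian_isSymm (G : SimpleGraph V) [DecidableRel G.Adj] (θ : V → ℝ) :
    (kuramotoHessian G θ).IsSymm := by
  refine Matrix.IsSymm.ext fun u v => ?_
  obtain rfl | huv := eq_or_ne u v
  · rfl
  · simp only [kuramotoHessian, if_neg huv, if_neg huv.symm, G.adj_comm v u, ← neg_sub (θ u),
      Real.cos_neg]

/-- The potential energy plus half the squared displacement of the total phase `∑ v, η v` from its
value at `θ`. Since the total phase is conserved, this still decreases along orbits; the added
square removes the degeneracy of the potential energy in the direction `(1, …, 1)`. -/
noncomputable def pinnedPotential (G : SimpleGraph V) [DecidableRel G.Adj] (θ η : V → ℝ) : ℝ :=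
  kuramotoPotential G η + (∑ v, (η v - θ v)) ^ 2 / 2

lemma hasFDerivAt_pinnedPotential (G : SimpleGraph V) [DecidableRel G.Adj] (θ η : V → ℝ) :
    HasFDerivAt (pinnedPotential G θ) ((dotProductBilin ℝ ℝ).toContinuousBilinearMap
      ((fun _ => ∑ v, (η v - θ v)) - kuramotoField G η)) η := by
  have hsum := HasFDerivAt.fun_sum (u := Finset.univ) fun v _ =>
    (hasFDerivAt_apply (𝕜 := ℝ) (F' := fun _ => ℝ) v η).sub_const (θ v)
  refine ((hasFDerivAt_kuramotoPotential G η).add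
    ((hsum.pow 2).mul_const (1 / 2))).congr_fderiv ?_ |>.congr_of_eventuallyEq ?_
  · ext x
    simp only [add_apply, neg_apply, sum_apply, smul_apply, ContinuousLinearMap.proj_apply,
      smul_eq_mul, map_sub, sub_apply, LinearMap.toContinuousBilinearMap_apply,
      dotProductBilin_apply_apply, dotProduct, ← Finset.mul_sum, Nat.add_one_sub_one, pow_one,
      nsmul_eq_mul, Nat.cast_ofNat]
    ring
  · exact .of_forall fun η => by simp [pinnedPotential, div_eq_mul_inv]

lemma IsKuramotoSolution.antitone_pinnedPotential {γ : ℝ → V → ℝ} (hγ : IsKuramotoSolution G γ)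
    (θ : V → ℝ) : Antitone (pinnedPotential G θ ∘ γ) := by
  refine antitone_of_hasDerivAt_nonpos
    (fun t => (hasFDerivAt_pinnedPotential G θ (γ t)).comp_hasDerivAt t (hγ t)) fun t => ?_
  have hsum : (fun _ => ∑ v, (γ t v - θ v)) ⬝ᵥ kuramotoField G (γ t) = 0 := by
    rw [dotProduct, ← Finset.mul_sum, sum_kuramotoField, mul_zero]
  change ((fun _ => ∑ v, (γ t v - θ v)) - kuramotoField G (γ t)) ⬝ᵥ kuramotoField G (γ t) ≤ 0
  rw [sub_dotProduct, hsum, zero_sub, neg_nonpos]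
  exact Finset.sum_nonneg fun v _ => mul_self_nonneg _

lemma IsLinearlyStableEquilibrium.posDef_hessian_add_one (h : IsLinearlyStableEquilibrium G θ) :
    (kuramotoHessian G θ + .of fun _ _ => 1).PosDef := by
  classical
  set A : Matrix V V ℝ := kuramotoHessian G θ + .of fun _ _ => 1 with hA
  have hAmul : ∀ x : V → ℝ, A.mulVec x = (kuramotoHessian G θ).mulVec x + fun _ => ∑ v, x v := by
    intro x
    rw [hA, Matrix.add_mulVec]
    congr 1
    ext v
    simp [Matrix.mulVec, dotProduct]
  have hsymm : A.IsHermitian := by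
    rw [Matrix.IsHermitian, Matrix.conjTranspose_eq_transpose_of_trivial, hA,
      Matrix.transpose_add, (kuramotoHessian_isSymm G θ).eq]
    rfl
  refine hsymm.posDef_iff_eigenvalues_pos.2 fun i => ?_
  set x : V → ℝ := ⇑(hsymm.eigenvectorBasis i)
  have hxne : x ≠ 0 := fun hx =>
    hsymm.eigenvectorBasis.orthonormal.ne_zero i (PiLp.ext (congrFun hx))
  have heigen : (kuramotoHessian G θ).mulVec x + (fun _ => ∑ v, x v) =
      hsymm.eigenvalues i • x := by
    rw [← hAmul]
    exact hsymm.mulVec_eigenvectorBasis i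
  obtain hzero | hne := eq_or_ne (∑ v, x v) 0
  · refine h.2 _ x hxne hzero ?_
    rwa [hzero, ← Pi.zero_def, add_zero] at heigen
  · have hsum : (Fintype.card V : ℝ) * ∑ v, x v = hsymm.eigenvalues i * ∑ v, x v := by
      simpa [Finset.sum_add_distrib, sum_kuramotoHessian_mulVec, Finset.mul_sum]
        using congrArg (fun y => ∑ v, y v) heigen
    have : Nonempty V := ⟨i⟩
    rw [← mul_right_cancel₀ hne hsum]
    exact_mod_cast Fintype.card_pos

lemma IsLinearlyStableEquilibrium.eventually_pinnedPotential_lt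
    (h : IsLinearlyStableEquilibrium G θ) :
    ∀ᶠ η in 𝓝[≠] θ, pinnedPotential G θ θ < pinnedPotential G θ η := by
  set Λ : (V → ℝ) →L[ℝ] (V → ℝ) →L[ℝ] ℝ := (dotProductBilin ℝ ℝ).toContinuousBilinearMap
  have hgradient : HasFDerivAt (fun η => (fun _ => ∑ v, (η v - θ v)) - kuramotoField G η)
      (kuramotoHessian G θ + .of fun _ _ => 1).mulVecLin.toContinuousLinearMap θ := by
    have hsum := HasFDerivAt.fun_sum (u := Finset.univ) fun v _ =>
      (hasFDerivAt_apply (𝕜 := ℝ) (F' := fun _ => ℝ) v θ).sub_const (θ v)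
    refine ((hasFDerivAt_pi.2 fun _ : V => hsum).sub
      (hasFDerivAt_kuramotoField G θ)).congr_fderiv ?_
    ext x v
    simp [Matrix.mulVec, dotProduct, add_comm]
  refine eventually_lt_of_isCoercive_hessian (.of_forall (hasFDerivAt_pinnedPotential G θ)) ?_
    (Λ.hasFDerivAt.comp θ hgradient) (isCoercive_of_forall_pos fun x hx => ?_)
  · have hfield : kuramotoField G θ = 0 := funext h.1
    simp only [sub_self, Finset.sum_const_zero, hfield, ← Pi.zero_def, map_zero]
  · have := h.posDef_hessian_add_one.dotProduct_mulVec_pos hx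
    rw [dotProduct_comm] at this
    exact this

lemma IsLinearlyStableEquilibrium.eventually_forall_dist_lt (h : IsLinearlyStableEquilibrium G θ)
    {ε : ℝ} (hε : 0 < ε) :
    ∀ᶠ x in 𝓝 θ, ∀ γ, IsKuramotoSolution G γ → γ 0 = x → ∀ t ≥ 0, dist (γ t) θ < ε := by
  have hcont : Continuous (pinnedPotential G θ) := continuous_iff_continuousAt.2 fun η =>
    (hasFDerivAt_pinnedPotential G θ η).continuousAt
  filter_upwards [eventually_forall_dist_lt_of_antitoneOn hcont h.eventually_pinnedPotential_lt hε]
    with x hx γ hγ hγ0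
  exact hx γ (continuous_iff_continuousAt.2 fun t => (hγ t).continuousAt) hγ0
    ((hγ.antitone_pinnedPotential θ).antitoneOn _)

theorem IsLinearlyStableEquilibrium.not_synchronizes (h : IsLinearlyStableEquilibrium G θ)
    (hcons : ¬ IsConsensus θ) : ¬ Synchronizes G := by
  intro hsync
  obtain ⟨u, v, huv⟩ := exists_cos_sub_lt_one_of_not_isConsensus hcons
  obtain ⟨b, hb, hb1⟩ := exists_between huv
  obtain ⟨ε, hε, hnear⟩ : ∃ ε > 0, ∀ η, dist η θ < ε → Real.cos (η u - η v) < b :=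
    Metric.eventually_nhds_iff.1
      ((show Continuous fun η : V → ℝ => Real.cos (η u - η v) by fun_prop).continuousAt
        |>.eventually_lt_const hb)
  have hdense := Measure.dense_of_ae hsync
  obtain ⟨x, ⟨γ, hγ, hγ0, hlim⟩, hstay⟩ :=
    ((mem_closure_iff_frequently.1 (hdense θ)).and_eventually
      (h.eventually_forall_dist_lt hε)).exists
  refine hb1.not_ge (le_of_tendsto (hlim.tendsto_cos_sub u v) ?_)
  filter_upwards [eventually_ge_atTop 0] with t ht
  exact (hnear _ (hstay γ hγ hγ0 t ht)).le

end Kuramoto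

section HessianForm

variable {V : Type*} [Fintype V]

/-- Twice the quadratic form of the Hessian at `φ` of the Kuramoto potential on the weighted graph
with adjacency matrix `W`, since every edge is summed in both directions. -/
noncomputable def hessianForm (W : Matrix V V ℕ) (φ m : V → ℝ) : ℝ :=
  ∑ u, ∑ v, W u v * Real.cos (φ u - φ v) * (m u - m v) ^ 2

lemma hessianForm_adjMatrix (G : SimpleGraph V) [DecidableRel G.Adj] (φ m : V → ℝ) :
    hessianForm (G.adjMatrix ℕ) φ m =
      ∑ v, ∑ u ∈ G.neighborFinset v, Real.cos (φ v - φ u) * (m v - m u) ^ 2 := by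
  simp only [hessianForm, SimpleGraph.adjMatrix_apply, SimpleGraph.neighborFinset_eq_filter,
    Finset.sum_filter, Nat.cast_ite, Nat.cast_one, Nat.cast_zero, ite_mul, one_mul, zero_mul]

lemma hessianForm_adjMatrix_eq_two_mul (G : SimpleGraph V) [DecidableRel G.Adj] (φ m : V → ℝ) :
    hessianForm (G.adjMatrix ℕ) φ m = 2 * (m ⬝ᵥ (kuramotoHessian G φ).mulVec m) := by
  simp only [hessianForm_adjMatrix, dotProduct, kuramotoHessian_mulVec, Finset.mul_sum]
  rw [← sub_eq_zero]
  simp only [← Finset.sum_sub_distrib]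
  refine sum_neighborFinset_eq_zero G fun u v => ?_
  rw [← neg_sub (φ u), Real.cos_neg]
  ring

lemma IsKuramotoEquilibrium.isLinearlyStable {G : SimpleGraph V} [DecidableRel G.Adj]
    {θ : V → ℝ} (h : IsKuramotoEquilibrium G θ)
    (hpos : ∀ x : V → ℝ, (∃ u v, x u ≠ x v) → 0 < hessianForm (G.adjMatrix ℕ) θ x) :
    IsLinearlyStableEquilibrium G θ := by
  refine ⟨h, fun l x hx hsum hl => ?_⟩
  have hne : ∃ u v, x u ≠ x v := by
    contrapose! hx
    ext u
    have : Nonempty V := ⟨u⟩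
    simpa [hx _ u] using hsum
  have hform := hpos x hne
  rw [hessianForm_adjMatrix_eq_two_mul, hl, dotProduct_smul, smul_eq_mul] at hform
  have hsq : 0 ≤ x ⬝ᵥ x := Finset.sum_nonneg fun v _ => mul_self_nonneg _
  exact pos_of_mul_pos_left (pos_of_mul_pos_right hform zero_le_two) hsq

end HessianForm

section Biregular

variable {ι κ : Type*} [Fintype ι] [Fintype κ] {R : ι → κ → Prop} [∀ i j, Decidable (R i j)]
  {d e : ℕ}

lemma sum_sum_filter_fst (hrow : ∀ i, Finset.card {j | R i j} = d) (f : ι → ℝ) :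
    ∑ i, ∑ j with R i j, f i = d * ∑ i, f i := by
  simp only [Finset.sum_const, hrow, nsmul_eq_mul, Finset.mul_sum]

lemma sum_sum_filter_snd (hcol : ∀ j, Finset.card {i | R i j} = e) (f : κ → ℝ) :
    ∑ i, ∑ j with R i j, f j = e * ∑ j, f j := by
  rw [Finset.sum_comm' (t' := Finset.univ) (s' := fun j => {i | R i j}) (by simp)]
  exact sum_sum_filter_fst (R := fun j i => R i j) hcol f

lemma sum_sq_sub_add_eq (hrow : ∀ i, Finset.card {j | R i j} = d)
    (hcol : ∀ j, Finset.card {i | R i j} = e) {α : ι → ℝ} {β : κ → ℝ} (hα : ∑ i, α i = 0)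
    (hβ : ∑ j, β j = 0) (δ : ℝ) :
    ∑ i, ∑ j with R i j, (α i - β j + δ) ^ 2 =
      Fintype.card ι * d * δ ^ 2 + ∑ i, ∑ j with R i j, (α i - β j) ^ 2 := by
  have hexpand : ∀ i j, (α i - β j + δ) ^ 2 =
      δ ^ 2 + 2 * δ * α i - 2 * δ * β j + (α i - β j) ^ 2 := fun i j => by ring
  simp only [hexpand, Finset.sum_add_distrib, Finset.sum_sub_distrib]
  rw [sum_sum_filter_fst hrow fun _ => δ ^ 2, sum_sum_filter_fst hrow fun i => 2 * δ * α i,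
    sum_sum_filter_snd hcol fun j => 2 * δ * β j, ← Finset.mul_sum, ← Finset.mul_sum, hα, hβ,
    Finset.sum_const, Finset.card_univ, nsmul_eq_mul]
  ring

lemma sum_sq_sub_le (hrow : ∀ i, Finset.card {j | R i j} = d)
    (hcol : ∀ j, Finset.card {i | R i j} = e) (α : ι → ℝ) (β : κ → ℝ) :
    ∑ i, ∑ j with R i j, (α i - β j) ^ 2 ≤ 2 * (d * ∑ i, α i ^ 2 + e * ∑ j, β j ^ 2) := by
  rw [← sum_sum_filter_fst hrow, ← sum_sum_filter_snd hcol]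
  simp only [← Finset.sum_add_distrib, Finset.mul_sum]
  refine Finset.sum_le_sum fun i _ => Finset.sum_le_sum fun j _ => ?_
  linarith [sq_nonneg (α i + β j)]

lemma mul_sum_sq_sub_add_ge (hrow : ∀ i, Finset.card {j | R i j} = d)
    (hcol : ∀ j, Finset.card {i | R i j} = e) {α : ι → ℝ} {β : κ → ℝ} (hα : ∑ i, α i = 0)
    (hβ : ∑ j, β j = 0) (δ c : ℝ) :
    Fintype.card ι * d * c * δ ^ 2 - 2 * c⁻ * (d * ∑ i, α i ^ 2 + e * ∑ j, β j ^ 2) ≤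
      c * ∑ i, ∑ j with R i j, (α i - β j + δ) ^ 2 := by
  have hupper := mul_le_mul_of_nonneg_left (sum_sq_sub_le hrow hcol α β) (negPart_nonneg c)
  have hlower : 0 ≤ c⁺ * ∑ i, ∑ j with R i j, (α i - β j) ^ 2 := by positivity
  rw [sum_sq_sub_add_eq hrow hcol hα hβ]
  nth_rewrite 1 3 [← posPart_sub_negPart c]
  linarith

lemma sum_sum_sq_sub {α : ι → ℝ} (hα : ∑ i, α i = 0) :
    ∑ i, ∑ j, (α i - α j) ^ 2 = 2 * Fintype.card ι * ∑ i, α i ^ 2 := by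
  simp only [sub_sq, Finset.sum_add_distrib, Finset.sum_sub_distrib, ← Finset.mul_sum, hα,
    Finset.sum_const, Finset.card_univ, nsmul_eq_mul, mul_zero]
  ring

end Biregular

section Equitable

/-- The partition of `V × ι` into the fibres over `V` is equitable with quotient matrix `W`: every
vertex over `u` has exactly `W u v` neighbours over `v`. -/
def IsEquitable {V ι : Type*} [Fintype ι] (Γ : SimpleGraph (V × ι)) [DecidableRel Γ.Adj]
    (W : Matrix V V ℕ) : Prop :=
  ∀ u v i, Finset.card {j | Γ.Adj (u, i) (v, j)} = W u v

/-- The mean of `x` over the fibre of `u`. -/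
noncomputable def fibreMean {V ι : Type*} [Fintype ι] (x : V × ι → ℝ) (u : V) : ℝ :=
  (∑ i, x (u, i)) / Fintype.card ι

/-- The sum of the squared deviations of `x` from its mean over the fibre of `u`. -/
noncomputable def fibreDev {V ι : Type*} [Fintype ι] (x : V × ι → ℝ) (u : V) : ℝ :=
  ∑ i, (x (u, i) - fibreMean x u) ^ 2

lemma sum_sub_fibreMean {V ι : Type*} [Fintype ι] (x : V × ι → ℝ) (u : V) :
    ∑ i, (x (u, i) - fibreMean x u) = 0 := by
  obtain _ | _ := isEmpty_or_nonempty ι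
  · exact Fintype.sum_empty _
  · rw [Finset.sum_sub_distrib, Finset.sum_const, Finset.card_univ, nsmul_eq_mul, fibreMean,
      mul_div_cancel₀ _ (Nat.cast_ne_zero.2 Fintype.card_ne_zero), sub_self]

lemma fibreDev_pos_of_ne {V ι : Type*} [Fintype ι] {x : V × ι → ℝ} {u : V} {i : ι}
    (h : x (u, i) ≠ fibreMean x u) : 0 < fibreDev x u :=
  Finset.sum_pos' (fun _ _ => sq_nonneg _)
    ⟨i, Finset.mem_univ i, sq_pos_of_ne_zero (sub_ne_zero.2 h)⟩

variable {V ι : Type*} [Fintype ι] {Γ : SimpleGraph (V × ι)} [DecidableRel Γ.Adj]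
  {W : Matrix V V ℕ}

lemma IsEquitable.cos_mul_sum_sq_sub_ge (h : IsEquitable Γ W) (φ : V → ℝ) (x : V × ι → ℝ)
    (u v : V) :
    Fintype.card ι * W u v * Real.cos (φ u - φ v) * (fibreMean x u - fibreMean x v) ^ 2 -
        2 * (Real.cos (φ u - φ v))⁻ * (W u v * fibreDev x u + W v u * fibreDev x v) ≤
      Real.cos (φ u - φ v) *
        ∑ i, ∑ j with Γ.Adj (u, i) (v, j), (x (u, i) - x (v, j)) ^ 2 := by
  have hcol : ∀ j, Finset.card {i | Γ.Adj (u, i) (v, j)} = W v u := fun j => by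
    simp only [← h v u j, Γ.adj_comm]
  refine (mul_sum_sq_sub_add_ge (h u v) hcol (sum_sub_fibreMean x u) (sum_sub_fibreMean x v)
    (fibreMean x u - fibreMean x v) (Real.cos (φ u - φ v))).trans_eq ?_
  congr 1
  refine Finset.sum_congr rfl fun i _ => Finset.sum_congr rfl fun j _ => ?_
  ring

lemma sum_sq_sub_of_fibre_complete (hΓ : ∀ u i j, i ≠ j → Γ.Adj (u, i) (u, j))
    (x : V × ι → ℝ) (u : V) :
    ∑ i, ∑ j with Γ.Adj (u, i) (u, j), (x (u, i) - x (u, j)) ^ 2 =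
      2 * Fintype.card ι * fibreDev x u := by
  rw [fibreDev, ← sum_sum_sq_sub (sum_sub_fibreMean x u)]
  refine Finset.sum_congr rfl fun i _ => ?_
  simp only [sub_sub_sub_cancel_right]
  refine Finset.sum_subset (Finset.filter_subset _ _) fun j _ hj => ?_
  obtain rfl : i = j := by_contra fun hij => hj (by simpa using hΓ u i j hij)
  ring

variable [Fintype V]

lemma sum_neighborFinset_prod {M : Type*} [AddCommMonoid M] (Γ : SimpleGraph (V × ι))
    [DecidableRel Γ.Adj] (x : V × ι) (f : V × ι → M) :
    ∑ y ∈ Γ.neighborFinset x, f y = ∑ v, ∑ j with Γ.Adj x (v, j), f (v, j) := by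
  simp only [SimpleGraph.neighborFinset_eq_filter, Finset.sum_filter, Fintype.sum_prod_type]

lemma IsEquitable.sum_neighborFinset {M : Type*} [AddCommMonoid M] (h : IsEquitable Γ W) (u : V)
    (i : ι) (f : V → M) : ∑ y ∈ Γ.neighborFinset (u, i), f y.1 = ∑ v, W u v • f v := by
  rw [sum_neighborFinset_prod]
  simp only [Finset.sum_const, h u _ i]

lemma IsEquitable.degree_eq (h : IsEquitable Γ W) (u : V) (i : ι) :
    Γ.degree (u, i) = ∑ v, W u v := by
  rw [← SimpleGraph.card_neighborFinset_eq_degree, Finset.card_eq_sum_ones,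
    h.sum_neighborFinset u i fun _ => 1]
  exact Finset.sum_congr rfl fun v _ => mul_one _

lemma IsEquitable.isKuramotoEquilibrium (h : IsEquitable Γ W) {φ : V → ℝ}
    (hφ : ∀ u, ∑ v, W u v * Real.sin (φ v - φ u) = 0) :
    IsKuramotoEquilibrium Γ (φ ∘ Prod.fst) := fun x => by
  simpa [hφ] using h.sum_neighborFinset x.1 x.2 fun v => Real.sin (φ v - φ x.1)

lemma hessianForm_adjMatrix_comp_fst (Γ : SimpleGraph (V × ι)) [DecidableRel Γ.Adj]
    (φ : V → ℝ) (x : V × ι → ℝ) :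
    hessianForm (Γ.adjMatrix ℕ) (φ ∘ Prod.fst) x = ∑ u, ∑ v, Real.cos (φ u - φ v) *
      ∑ i, ∑ j with Γ.Adj (u, i) (v, j), (x (u, i) - x (v, j)) ^ 2 := by
  simp only [hessianForm_adjMatrix, sum_neighborFinset_prod, Fintype.sum_prod_type,
    Function.comp_apply, Finset.mul_sum]
  exact Finset.sum_congr rfl fun u _ => Finset.sum_comm

lemma IsEquitable.hessianForm_ge (h : IsEquitable Γ W)
    (hΓ : ∀ u i j, i ≠ j → Γ.Adj (u, i) (u, j)) (φ : V → ℝ) (x : V × ι → ℝ) :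
    Fintype.card ι * hessianForm W φ (fibreMean x) +
        2 * ∑ u, (Fintype.card ι - 2 * ∑ v, W u v * (Real.cos (φ u - φ v))⁻) * fibreDev x u ≤
      hessianForm (Γ.adjMatrix ℕ) (φ ∘ Prod.fst) x := by
  classical
  have hpair : ∀ u v,
      Fintype.card ι * W u v * Real.cos (φ u - φ v) * (fibreMean x u - fibreMean x v) ^ 2 -
          2 * (Real.cos (φ u - φ v))⁻ * (W u v * fibreDev x u + W v u * fibreDev x v) +
          (if u = v then 2 * Fintype.card ι * fibreDev x u else 0) ≤
        Real.cos (φ u - φ v) *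
          ∑ i, ∑ j with Γ.Adj (u, i) (v, j), (x (u, i) - x (v, j)) ^ 2 := by
    intro u v
    obtain rfl | huv := eq_or_ne u v
    · simp [sum_sq_sub_of_fibre_complete hΓ]
    · simpa only [if_neg huv, add_zero] using h.cos_mul_sum_sq_sub_ge φ x u v
  have hcomm : ∑ u, ∑ v, (Real.cos (φ u - φ v))⁻ * (W v u * fibreDev x v) =
      ∑ u, ∑ v, (Real.cos (φ u - φ v))⁻ * (W u v * fibreDev x u) := by
    rw [Finset.sum_comm]
    refine Finset.sum_congr rfl fun u _ => Finset.sum_congr rfl fun v _ => ?_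
    rw [← neg_sub (φ u), Real.cos_neg]
  have hdev : ∑ u, (Fintype.card ι - 2 * ∑ v, W u v * (Real.cos (φ u - φ v))⁻) * fibreDev x u =
      Fintype.card ι * ∑ u, fibreDev x u -
        2 * ∑ u, ∑ v, (Real.cos (φ u - φ v))⁻ * (W u v * fibreDev x u) := by
    simp only [sub_mul, Finset.sum_sub_distrib, Finset.mul_sum, Finset.sum_mul]
    congr 1
    refine Finset.sum_congr rfl fun u _ => Finset.sum_congr rfl fun v _ => ?_
    ring
  rw [hessianForm_adjMatrix_comp_fst, hdev]
  refine le_trans (le_of_eq ?_)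
    (Finset.sum_le_sum fun u _ => Finset.sum_le_sum fun v _ => hpair u v)
  simp only [Finset.sum_add_distrib, Finset.sum_sub_distrib, mul_add, Finset.sum_ite_eq,
    Finset.mem_univ, if_true, mul_assoc, ← Finset.mul_sum, hcomm, hessianForm]
  ring

theorem IsEquitable.isLinearlyStableEquilibrium_comp_fst (h : IsEquitable Γ W)
    (hΓ : ∀ u i j, i ≠ j → Γ.Adj (u, i) (u, j)) {φ : V → ℝ}
    (hφ : ∀ u, ∑ v, W u v * Real.sin (φ v - φ u) = 0)
    (hW : ∀ m : V → ℝ, (∃ u v, m u ≠ m v) → 0 < hessianForm W φ m)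
    (hneg : ∀ u, 2 * ∑ v, W u v * (Real.cos (φ u - φ v))⁻ < Fintype.card ι) :
    IsLinearlyStableEquilibrium Γ (φ ∘ Prod.fst) := by
  refine (h.isKuramotoEquilibrium hφ).isLinearlyStable fun x hx => ?_
  refine lt_of_lt_of_le ?_ (h.hessianForm_ge hΓ φ x)
  have hdev : ∀ u, 0 ≤ (Fintype.card ι - 2 * ∑ v, W u v * (Real.cos (φ u - φ v))⁻) *
      fibreDev x u := fun u =>
    mul_nonneg (sub_nonneg.2 (hneg u).le) (Finset.sum_nonneg fun i _ => sq_nonneg _)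
  obtain ⟨⟨u, i⟩, ⟨v, j⟩, hne⟩ := hx
  have : Nonempty ι := ⟨i⟩
  have hcard : (0 : ℝ) < Fintype.card ι := Nat.cast_pos.2 Fintype.card_pos
  by_cases hmean : ∃ u v, fibreMean x u ≠ fibreMean x v
  · have := mul_pos hcard (hW _ hmean)
    have := Finset.sum_nonneg fun u (_ : u ∈ Finset.univ) => hdev u
    positivity
  · push Not at hmean
    obtain ⟨w, l, hw⟩ : ∃ w l, x (w, l) ≠ fibreMean x w := by
      by_contra! hconst
      exact hne (by rw [hconst, hconst, hmean u v])
    have hform : hessianForm W φ (fibreMean x) = 0 := by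
      simp [hessianForm, fun u v => sub_eq_zero.2 (hmean u v)]
    rw [hform, mul_zero, zero_add]
    exact mul_pos two_pos (Finset.sum_pos' (fun u _ => hdev u) ⟨w, Finset.mem_univ w,
      mul_pos (sub_pos.2 (hneg w)) (fibreDev_pos_of_ne hw)⟩)

end Equitable

section Spinning

variable {V : Type*} {k : ℕ}

/-- The matrix counting, for fibres `u` and `v` of the `k`-spinning of `G`, the neighbours in the
fibre of `v` of a vertex in the fibre of `u`; it is correct as soon as no weight exceeds `k`. -/
def spinningQuotient [DecidableEq V] (G : WeightedGraph V) [DecidableRel G.graph.Adj] (k : ℕ) :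
    Matrix V V ℕ :=
  fun u v => if u = v then k - 1 else if G.graph.Adj u v then G.weight s(u, v) else 0

lemma exists_lt_eq_add_iff_val_lt [NeZero k] {d : ℕ} (hd : d ≤ k) (i j : ZMod k) :
    (∃ h < d, j = i + (h : ZMod k)) ↔ (j - i).val < d := by
  constructor
  · rintro ⟨h, hh, rfl⟩
    rwa [add_sub_cancel_left, ZMod.val_cast_of_lt (hh.trans_le hd)]
  · exact fun h => ⟨_, h, by rw [ZMod.natCast_zmod_val, add_sub_cancel]⟩

lemma card_filter_val_lt [NeZero k] {d : ℕ} (hd : d ≤ k) :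
    Finset.card {x : ZMod k | x.val < d} = d := by
  conv_rhs => rw [← Finset.card_range d]
  refine Finset.card_bij (fun x _ => x.val) (by simp) (fun x _ y _ h => ZMod.val_injective k h)
    fun n hn => ?_
  have hn := Finset.mem_range.1 hn
  have hval : (n : ZMod k).val = n := ZMod.val_cast_of_lt (hn.trans_le hd)
  exact ⟨n, by simpa [hval] using hn, hval⟩

lemma spinning_adj_same_fibre (G : WeightedGraph V) (u : V) (i j : ZMod k) :
    (spinning G k).Adj (u, i) (u, j) ↔ i ≠ j := by
  simpa [spinning] using fun h : i ≠ j => Or.inl (Or.inl h)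

lemma spinning_adj_of_arc (G : WeightedGraph V) {u v : V} (huv : G.arc u v) (i j : ZMod k) :
    (spinning G k).Adj (u, i) (v, j) ↔ ∃ h < G.weight s(u, v), j = i + (h : ZMod k) := by
  have hne : u ≠ v := by rintro rfl; exact G.arc_asymm _ _ huv huv
  simp [spinning, huv, G.arc_asymm _ _ huv, hne, hne.symm]

theorem isEquitable_spinning [DecidableEq V] [NeZero k] (G : WeightedGraph V)
    [DecidableRel G.graph.Adj] (hk : ∀ u v, G.arc u v → G.weight s(u, v) ≤ k) :
    IsEquitable (spinning G k) (spinningQuotient G k) := by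
  intro u v i
  unfold spinningQuotient
  split_ifs with h hadj
  · subst h
    simp [spinning_adj_same_fibre, Finset.filter_ne, ZMod.card]
  · obtain huv | hvu := (G.arc_or u v).1 hadj
    · simp only [spinning_adj_of_arc G huv, exists_lt_eq_add_iff_val_lt (hk u v huv)]
      exact (Finset.card_equiv (Equiv.subRight i) (by simp)).trans (card_filter_val_lt (hk u v huv))
    · simp only [(spinning G k).adj_comm (u, i), spinning_adj_of_arc G hvu,
        exists_lt_eq_add_iff_val_lt (hk v u hvu), Sym2.eq_swap (a := u)]
      exact (Finset.card_equiv (Equiv.subLeft i) (by simp)).trans (card_filter_val_lt (hk v u hvu))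
  · rw [G.arc_or, not_or] at hadj
    simp [spinning, h, Ne.symm h, hadj]

end Spinning

section OctagonalGraph

/-- The sign `1` at the even vertices of `ℤ_8` and `-1` at the odd ones. The operation
`(u, t) ↦ u + parity u * t` makes `ℤ_8` a dihedral group of order `8`, and `G_p` is a weighted
Cayley graph of this group. -/
def parity (u : ZMod 8) : ℤ := (-1) ^ u.val

/-- The number of edges of the `k`-spinning of `G_p` from a vertex over `u` to the fibre over
`u + parity u * t`; it does not depend on `u`. -/
def stepWeight (a b c d k : ℕ) : ZMod 8 → ℕ := ![k - 1, a, b, 0, 0, d, b, c]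

instance (a b c d : ℕ) : DecidableRel (weightedG a b c d).graph.Adj :=
  inferInstanceAs (DecidableRel (SimpleGraph.fromRel _).Adj)

lemma spinningQuotient_weightedG (a b c d k : ℕ) (u t : ZMod 8) :
    spinningQuotient (weightedG a b c d) k u (u + parity u * t) = stepWeight a b c d k t := by
  fin_cases u <;> fin_cases t <;> rfl

lemma sum_parity_mul {M : Type*} [AddCommMonoid M] (u : ZMod 8) (f : ZMod 8 → M) :
    ∑ v, f v = ∑ t, f (u + parity u * t) := by
  have hbij : ∀ u : ZMod 8, Function.Bijective fun t : ZMod 8 => u + parity u * t := by decide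
  exact ((hbij u).sum_comp f).symm

lemma sum_stepWeight_mul {R : Type*} [Semiring R] (a b c d k : ℕ) (f : ZMod 8 → R) :
    ∑ t, stepWeight a b c d k t * f t = (k - 1 : ℕ) * f 0 + a * f 1 + b * f 2 + d * f 5 +
      b * f 6 + c * f 7 := by
  refine (Fin.sum_univ_eight fun t : ZMod 8 => (stepWeight a b c d k t : R) * f t).trans ?_
  change ((k - 1 : ℕ) : R) * f 0 + a * f 1 + b * f 2 + (0 : ℕ) * f 3 + (0 : ℕ) * f 4 + d * f 5 +
    b * f 6 + c * f 7 = _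
  simp only [Nat.cast_zero, zero_mul, add_zero]

lemma isEquitable_spinning_weightedG {a b c d k : ℕ} [NeZero k] (ha : a ≤ k) (hb : b ≤ k)
    (hc : c ≤ k) (hd : d ≤ k) :
    IsEquitable (spinning (weightedG a b c d) k) (spinningQuotient (weightedG a b c d) k) :=
  isEquitable_spinning _ fun u v _ => by
    simp only [weightedG, Sym2.lift_mk]
    split_ifs <;> omega

theorem isRegularOfDegree_spinning_weightedG {a b c d k : ℕ} [NeZero k] (ha : a ≤ k) (hb : b ≤ k)
    (hc : c ≤ k) (hd : d ≤ k) :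
    (spinning (weightedG a b c d) k).IsRegularOfDegree (k - 1 + a + 2 * b + c + d) := by
  rintro ⟨u, i⟩
  rw [(isEquitable_spinning_weightedG ha hb hc hd).degree_eq, sum_parity_mul u]
  have hsum := sum_stepWeight_mul a b c d k fun _ => 1
  simp only [Nat.cast_id, mul_one] at hsum
  simp only [spinningQuotient_weightedG, hsum]
  ring

/-- The phase `iπ/2` at the vertex `2i` and `iπ/2 + φ` at the vertex `2i + 1` of `ℤ_8`. -/
noncomputable def twistPhase (φ : ℝ) (u : ZMod 8) : ℝ :=
  (u.val / 2 : ℕ) * (Real.pi / 2) + (u.val % 2 : ℕ) * φ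

lemma coe_twistPhase_add_parity_mul (φ : ℝ) (u t : ZMod 8) :
    (twistPhase φ (u + parity u * t) : Real.Angle) =
      ((twistPhase φ u + parity u * twistPhase φ t : ℝ) : Real.Angle) := by
  have hdiv : ∀ u t : ZMod 8, (4 : ℤ) ∣ ((u + parity u * t).val / 2 : ℕ) -
      ((u.val / 2 : ℕ) + parity u * (t.val / 2 : ℕ)) := by decide
  have hmod : ∀ u t : ZMod 8, (((u + parity u * t).val % 2 : ℕ) : ℤ) =
      (u.val % 2 : ℕ) + parity u * (t.val % 2 : ℕ) := by decide
  obtain ⟨n, hn⟩ := hdiv u t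
  have hmod := congrArg (Int.cast (R := ℝ)) (hmod u t)
  have hn := congrArg (Int.cast (R := ℝ)) hn
  simp only [Int.cast_sub, Int.cast_add, Int.cast_mul, Int.cast_natCast, Int.cast_ofNat] at hmod hn
  rw [Real.Angle.angle_eq_iff_two_pi_dvd_sub]
  refine ⟨n, ?_⟩
  simp only [twistPhase]
  linear_combination Real.pi / 2 * hn + φ * hmod

lemma cos_twistPhase_sub (φ : ℝ) (u t : ZMod 8) :
    Real.cos (twistPhase φ u - twistPhase φ (u + parity u * t)) = Real.cos (twistPhase φ t) := by
  rw [← Real.Angle.cos_coe, Real.Angle.coe_sub, coe_twistPhase_add_parity_mul, ← Real.Angle.coe_sub,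
    Real.Angle.cos_coe, sub_add_cancel_left, Real.cos_neg]
  obtain h | h := neg_one_pow_eq_or ℤ u.val <;> simp [parity, h]

lemma sin_twistPhase_sub (φ : ℝ) (u t : ZMod 8) :
    Real.sin (twistPhase φ (u + parity u * t) - twistPhase φ u) =
      parity u * Real.sin (twistPhase φ t) := by
  rw [← Real.Angle.sin_coe, Real.Angle.coe_sub, coe_twistPhase_add_parity_mul, ← Real.Angle.coe_sub,
    Real.Angle.sin_coe, add_sub_cancel_left]
  obtain h | h := neg_one_pow_eq_or ℤ u.val <;> simp [parity, h]

lemma twistPhase_zero (φ : ℝ) : twistPhase φ 0 = 0 := by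
  change ((0 : ℕ) : ℝ) * (Real.pi / 2) + (0 : ℕ) * φ = _
  push_cast
  ring

lemma twistPhase_one (φ : ℝ) : twistPhase φ 1 = φ := by
  change ((0 : ℕ) : ℝ) * (Real.pi / 2) + (1 : ℕ) * φ = _
  push_cast
  ring

lemma twistPhase_two (φ : ℝ) : twistPhase φ 2 = Real.pi / 2 := by
  change ((1 : ℕ) : ℝ) * (Real.pi / 2) + (0 : ℕ) * φ = _
  push_cast
  ring

lemma twistPhase_five (φ : ℝ) : twistPhase φ 5 = φ + Real.pi := by
  change ((2 : ℕ) : ℝ) * (Real.pi / 2) + (1 : ℕ) * φ = _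
  push_cast
  ring

lemma twistPhase_six (φ : ℝ) : twistPhase φ 6 = Real.pi / 2 + Real.pi := by
  change ((3 : ℕ) : ℝ) * (Real.pi / 2) + (0 : ℕ) * φ = _
  push_cast
  ring

lemma twistPhase_seven (φ : ℝ) : twistPhase φ 7 = φ + Real.pi / 2 + Real.pi := by
  change ((3 : ℕ) : ℝ) * (Real.pi / 2) + (1 : ℕ) * φ = _
  push_cast
  ring

lemma not_isConsensus_twistPhase_comp_fst (φ : ℝ) {ι : Type*} [Nonempty ι] :
    ¬ IsConsensus (twistPhase φ ∘ Prod.fst : ZMod 8 × ι → ℝ) := by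
  rintro ⟨θ, hθ⟩
  obtain ⟨i⟩ := ‹Nonempty ι›
  have hcos := congrArg Real.Angle.cos ((hθ (0, i)).trans (hθ (2, i)).symm)
  simp [twistPhase_zero, twistPhase_two] at hcos

lemma sum_spinningQuotient_mul_sin_twistPhase (a b c d k : ℕ) (φ : ℝ) (u : ZMod 8) :
    ∑ v, spinningQuotient (weightedG a b c d) k u v * Real.sin (twistPhase φ v - twistPhase φ u) =
      parity u * ((a - d) * Real.sin φ - c * Real.cos φ) := by
  rw [sum_parity_mul u]
  simp only [spinningQuotient_weightedG, sin_twistPhase_sub, mul_left_comm _ (parity u : ℝ),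
    ← Finset.mul_sum]
  rw [sum_stepWeight_mul a b c d k fun t => Real.sin (twistPhase φ t)]
  simp only [twistPhase_zero, twistPhase_one, twistPhase_two, twistPhase_five, twistPhase_six,
    twistPhase_seven, Real.sin_zero, Real.sin_add_pi, Real.sin_pi_div_two, Real.sin_add_pi_div_two]
  ring

lemma sum_spinningQuotient_mul_negPart_cos_twistPhase (a b c d k : ℕ) {φ : ℝ}
    (hsin : 0 ≤ Real.sin φ) (hcos : 0 ≤ Real.cos φ) (u : ZMod 8) :
    ∑ v, spinningQuotient (weightedG a b c d) k u v *
      (Real.cos (twistPhase φ u - twistPhase φ v))⁻ = d * Real.cos φ := by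
  rw [sum_parity_mul u]
  simp only [spinningQuotient_weightedG, cos_twistPhase_sub]
  rw [sum_stepWeight_mul a b c d k fun t => (Real.cos (twistPhase φ t))⁻]
  simp [twistPhase_zero, twistPhase_one, twistPhase_two, twistPhase_five, twistPhase_six,
    twistPhase_seven, Real.cos_add_pi, Real.cos_add_pi_div_two, negPart_of_nonneg,
    negPart_of_nonpos, hsin, hcos]

/-- The quadratic form of a weighted octagon `01234567` with alternating weights `p` and `q`, with
chords of weight `-r` joining `2i` to `2i + 5`. -/
def octagonForm (p q r : ℝ) (m : ZMod 8 → ℝ) : ℝ :=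
  p * ((m 0 - m 1) ^ 2 + (m 2 - m 3) ^ 2 + (m 4 - m 5) ^ 2 + (m 6 - m 7) ^ 2) +
    q * ((m 1 - m 2) ^ 2 + (m 3 - m 4) ^ 2 + (m 5 - m 6) ^ 2 + (m 7 - m 0) ^ 2) -
    r * ((m 0 - m 5) ^ 2 + (m 2 - m 7) ^ 2 + (m 4 - m 1) ^ 2 + (m 6 - m 3) ^ 2)

lemma hessianForm_twistPhase (a b c d k : ℕ) (φ : ℝ) (m : ZMod 8 → ℝ) :
    hessianForm (spinningQuotient (weightedG a b c d) k) (twistPhase φ) m =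
      2 * octagonForm (a * Real.cos φ) (c * Real.sin φ) (d * Real.cos φ) m := by
  have hrow : ∀ u, ∑ v, spinningQuotient (weightedG a b c d) k u v *
      Real.cos (twistPhase φ u - twistPhase φ v) * (m u - m v) ^ 2 =
      a * Real.cos φ * (m u - m (u + parity u * 1)) ^ 2 +
        c * Real.sin φ * (m u - m (u + parity u * 7)) ^ 2 -
        d * Real.cos φ * (m u - m (u + parity u * 5)) ^ 2 := by
    intro u
    rw [sum_parity_mul u]
    simp only [spinningQuotient_weightedG, cos_twistPhase_sub, mul_assoc]
    rw [sum_stepWeight_mul a b c d k fun t =>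
      Real.cos (twistPhase φ t) * (m u - m (u + parity u * t)) ^ 2]
    simp only [twistPhase_zero, twistPhase_one, twistPhase_two, twistPhase_five, twistPhase_six,
      twistPhase_seven, Real.cos_add_pi, Real.cos_pi_div_two, Real.cos_add_pi_div_two, mul_zero,
      add_zero, sub_self]
    ring
  have hsum_one : ∑ u, (m u - m (u + parity u * 1)) ^ 2 =
      (m 0 - m 1) ^ 2 + (m 1 - m 0) ^ 2 + (m 2 - m 3) ^ 2 + (m 3 - m 2) ^ 2 +
      (m 4 - m 5) ^ 2 + (m 5 - m 4) ^ 2 + (m 6 - m 7) ^ 2 + (m 7 - m 6) ^ 2 :=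
    Fin.sum_univ_eight _
  have hsum_five : ∑ u, (m u - m (u + parity u * 5)) ^ 2 =
      (m 0 - m 5) ^ 2 + (m 1 - m 4) ^ 2 + (m 2 - m 7) ^ 2 + (m 3 - m 6) ^ 2 +
      (m 4 - m 1) ^ 2 + (m 5 - m 0) ^ 2 + (m 6 - m 3) ^ 2 + (m 7 - m 2) ^ 2 :=
    Fin.sum_univ_eight _
  have hsum_seven : ∑ u, (m u - m (u + parity u * 7)) ^ 2 =
      (m 0 - m 7) ^ 2 + (m 1 - m 2) ^ 2 + (m 2 - m 1) ^ 2 + (m 3 - m 4) ^ 2 +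
      (m 4 - m 3) ^ 2 + (m 5 - m 6) ^ 2 + (m 6 - m 5) ^ 2 + (m 7 - m 0) ^ 2 :=
    Fin.sum_univ_eight _
  simp only [hessianForm, hrow, Finset.sum_sub_distrib, Finset.sum_add_distrib, ← Finset.mul_sum,
    hsum_one, hsum_five, hsum_seven, octagonForm]
  ring

/-- The form splits into a part in the sums `m j + m (j + 4)` and a part in the differences
`m j - m (j + 4)`. In the latter, completing the squares of `m 0 - m 4` and `m 2 - m 6` leaves the
last term, as `(p + q - r) ^ 2 - (p + r) ^ 2 - q ^ 2 = 2 * (q * (p - r) - 2 * p * r)`. -/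
lemma octagonForm_eq_sum_sq (p q r : ℝ) (m : ZMod 8 → ℝ) :
    2 * (p + q - r) * octagonForm p q r m =
      (p + q - r) * ((p - r) * ((m 1 + m 5 - (m 0 + m 4)) ^ 2 + (m 3 + m 7 - (m 2 + m 6)) ^ 2) +
        q * ((m 2 + m 6 - (m 1 + m 5)) ^ 2 + (m 0 + m 4 - (m 3 + m 7)) ^ 2)) +
      ((p + q - r) * (m 0 - m 4) - (p + r) * (m 1 - m 5) + q * (m 3 - m 7)) ^ 2 +
      ((p + q - r) * (m 2 - m 6) - (p + r) * (m 3 - m 7) - q * (m 1 - m 5)) ^ 2 +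
      2 * (q * (p - r) - 2 * p * r) * ((m 1 - m 5) ^ 2 + (m 3 - m 7) ^ 2) := by
  unfold octagonForm
  ring

lemma octagonForm_pos {p q r : ℝ} (hq : 0 < q) (hrp : r < p) (hpqr : 2 * p * r < q * (p - r))
    {m : ZMod 8 → ℝ} (hm : ∃ u v, m u ≠ m v) : 0 < octagonForm p q r m := by
  have hpr : 0 < p - r := sub_pos.2 hrp
  have hn : 0 < p + q - r := by linarith
  have he : 0 < q * (p - r) - 2 * p * r := sub_pos.2 hpqr
  by_contra! hle
  have hsos := le_antisymm ((octagonForm_eq_sum_sq p q r m).symm.trans_le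
    (mul_nonpos_of_nonneg_of_nonpos (by positivity) hle)) (by positivity)
  simp (discharger := positivity) only [add_eq_zero_iff_of_nonneg, mul_eq_zero, hn.ne', hpr.ne',
    hq.ne', he.ne', OfNat.ofNat_ne_zero, false_or, pow_eq_zero_iff] at hsos
  obtain ⟨⟨⟨⟨⟨h01, h23⟩, h12, -⟩, h04⟩, h26⟩, h15, h37⟩ := hsos
  rw [h15, h37, mul_zero, mul_zero, sub_zero, add_zero, mul_eq_zero_iff_left hn.ne'] at h04
  rw [h15, h37, mul_zero, mul_zero, sub_zero, sub_zero, mul_eq_zero_iff_left hn.ne'] at h26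
  obtain ⟨u, v, huv⟩ := hm
  have hconst : ∀ u, m u = m 0 := by
    intro u
    fin_cases u
    exacts [rfl, (by linarith : m 1 = m 0), (by linarith : m 2 = m 0), (by linarith : m 3 = m 0),
      (by linarith : m 4 = m 0), (by linarith : m 5 = m 0), (by linarith : m 6 = m 0),
      (by linarith : m 7 = m 0)]
  exact huv ((hconst u).trans (hconst v).symm)

theorem isLinearlyStableEquilibrium_twistPhase_comp_fst {a b c d k : ℕ} [NeZero k] {φ : ℝ}
    (ha : a ≤ k) (hb : b ≤ k) (hc : c ≤ k) (hd : 2 * d ≤ k) (hda : d < a)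
    (hadc : 2 * a * d < c ^ 2) (hsin : 0 < Real.sin φ) (hcos : 0 < Real.cos φ)
    (hφ : (a - d) * Real.sin φ = c * Real.cos φ) :
    IsLinearlyStableEquilibrium (spinning (weightedG a b c d) k) (twistPhase φ ∘ Prod.fst) := by
  have hc_pos : 0 < (c : ℝ) := Nat.cast_pos.2 (Nat.pos_of_ne_zero fun h => by simp [h] at hadc)
  refine (isEquitable_spinning_weightedG ha hb hc (by omega)).isLinearlyStableEquilibrium_comp_fst
    (fun u i j => (spinning_adj_same_fibre _ u i j).2) (fun u => ?_) (fun m hm => ?_) fun u => ?_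
  · rw [sum_spinningQuotient_mul_sin_twistPhase, hφ, sub_self, mul_zero]
  · rw [hessianForm_twistPhase]
    refine mul_pos two_pos (octagonForm_pos (by positivity) (by gcongr) ?_ hm)
    calc 2 * (a * Real.cos φ) * (d * Real.cos φ) = (2 * a * d : ℕ) * Real.cos φ ^ 2 := by
          push_cast
          ring
      _ < (c ^ 2 : ℕ) * Real.cos φ ^ 2 := by gcongr
      _ = c * Real.sin φ * (a * Real.cos φ - d * Real.cos φ) := by
          push_cast
          linear_combination -c * Real.cos φ * hφ
  · rw [sum_spinningQuotient_mul_negPart_cos_twistPhase a b c d k hsin.le hcos.le, ZMod.card,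
      ← mul_assoc]
    have hcos_lt : Real.cos φ < 1 := by nlinarith [Real.sin_sq_add_cos_sq φ]
    calc 2 * d * Real.cos φ ≤ k * Real.cos φ := by gcongr; exact_mod_cast hd
      _ < k := mul_lt_of_lt_one_right (Nat.cast_pos.2 (NeZero.pos k)) hcos_lt

theorem exists_isLinearlyStableEquilibrium_not_isConsensus {a b c d k : ℕ} [NeZero k]
    (ha : a ≤ k) (hb : b ≤ k) (hc : c ≤ k) (hd : 2 * d ≤ k) (hda : d < a)
    (hadc : 2 * a * d < c ^ 2) :
    ∃ θ, IsLinearlyStableEquilibrium (spinning (weightedG a b c d) k) θ ∧ ¬ IsConsensus θ := by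
  have hda_pos : 0 < (a : ℝ) - d := sub_pos.2 (Nat.cast_lt.2 hda)
  have hc_pos : 0 < (c : ℝ) := Nat.cast_pos.2 (Nat.pos_of_ne_zero fun h => by simp [h] at hadc)
  set φ := Real.arctan (c / (a - d))
  have hcos : 0 < Real.cos φ := Real.cos_arctan_pos _
  have hφ : (a - d) * Real.sin φ = c * Real.cos φ := by
    rw [← Real.tan_mul_cos hcos.ne', Real.tan_arctan, ← mul_assoc, mul_div_cancel₀ _ hda_pos.ne']
  have hsin : 0 < Real.sin φ := pos_of_mul_pos_right (hφ ▸ mul_pos hc_pos hcos) hda_pos.le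
  exact ⟨_, isLinearlyStableEquilibrium_twistPhase_comp_fst ha hb hc hd hda hadc hsin hcos hφ,
    not_isConsensus_twistPhase_comp_fst φ⟩

end OctagonalGraph

section CriticalConnectivity

lemma strongDensity_le_one {V : Type*} [Fintype V] [Nonempty V] (G : SimpleGraph V)
    [DecidableRel G.Adj] : strongDensity G ≤ 1 := by
  have hδ : (G.minDegree : ℝ) + 1 ≤ Fintype.card V := mod_cast G.minDegree_lt_card
  exact div_le_one_of_le₀ (by linarith) (by linarith [G.minDegree.cast_nonneg (α := ℝ)])

lemma strongDensity_le_criticalConnectivity {V : Type} [Fintype V] [Nonempty V]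
    (G : SimpleGraph V) [DecidableRel G.Adj] (hG : ¬ Synchronizes G) :
    strongDensity G ≤ criticalConnectivity :=
  le_csInf ⟨1, fun _ _ _ H _ hH => absurd hH (strongDensity_le_one H).not_gt⟩
    fun _ hμ => not_lt.1 fun hlt => hG (hμ _ G hlt)

lemma two_mul_ceil_half_sub_one_lt {k : ℕ} (hk : 0 < k) : 2 * (⌈(k : ℝ) / 2⌉₊ - 1) < k := by
  have hceil := Nat.ceil_lt_add_one (show 0 ≤ (k : ℝ) / 2 by positivity)
  have : 2 * ⌈(k : ℝ) / 2⌉₊ < k + 2 := by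
    have : (2 * ⌈(k : ℝ) / 2⌉₊ : ℝ) < k + 2 := by linarith
    exact_mod_cast this
  omega

variable (k : ℕ) [NeZero k]

theorem isRegularOfDegree_spinG :
    (spinG k).IsRegularOfDegree (5 * k + ⌈(k : ℝ) / 2⌉₊ - 2) := by
  have hk := NeZero.pos k
  have hceil : 0 < ⌈(k : ℝ) / 2⌉₊ := Nat.ceil_pos.2 (by positivity)
  have hd := two_mul_ceil_half_sub_one_lt hk
  have hdeg : 5 * k + ⌈(k : ℝ) / 2⌉₊ - 2 = k - 1 + k + 2 * k + k + (⌈(k : ℝ) / 2⌉₊ - 1) := by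
    omega
  exact hdeg ▸ isRegularOfDegree_spinning_weightedG le_rfl le_rfl le_rfl (by omega)

theorem exists_isLinearlyStableEquilibrium_spinG :
    ∃ θ, IsLinearlyStableEquilibrium (spinG k) θ ∧ ¬ IsConsensus θ := by
  have hd := two_mul_ceil_half_sub_one_lt (NeZero.pos k)
  exact exists_isLinearlyStableEquilibrium_not_isConsensus le_rfl le_rfl le_rfl hd.le (by omega)
    (by nlinarith)

theorem not_synchronizes_spinG : ¬ Synchronizes (spinG k) :=
  let ⟨_, hθ, hcons⟩ := exists_isLinearlyStableEquilibrium_spinG k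
  hθ.not_synchronizes hcons

lemma strongDensity_spinG :
    strongDensity (spinG k) = (5 * k + ⌈(k : ℝ) / 2⌉₊ - 2) / (8 * k - 1) := by
  have hk := NeZero.pos k
  rw [strongDensity, (isRegularOfDegree_spinG k).minDegree_eq, Fintype.card_prod, ZMod.card,
    ZMod.card, Nat.cast_sub (by omega)]
  push_cast
  rfl

theorem tendsto_strongDensity_spinG :
    Tendsto (fun k : ℕ => strongDensity (spinG (k + 1))) atTop (𝓝 (11 / 16)) := by
  have hinv : Tendsto (fun k : ℕ => (k : ℝ)⁻¹) atTop (𝓝 0) := tendsto_inv_atTop_nhds_zero_nat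
  have hceil : Tendsto (fun k : ℕ => (⌈(k : ℝ) / 2⌉₊ / k : ℝ)) atTop (𝓝 2⁻¹) := by
    simpa only [div_eq_inv_mul, Function.comp_def] using
      (tendsto_nat_ceil_mul_div_atTop (R := ℝ) (inv_nonneg.2 two_pos.le)).comp
        tendsto_natCast_atTop_atTop
  have hlim : Tendsto (fun k : ℕ => (5 + ⌈(k : ℝ) / 2⌉₊ / k - 2 * (k : ℝ)⁻¹) / (8 - (k : ℝ)⁻¹))
      atTop (𝓝 ((5 + 2⁻¹ - 2 * 0) / (8 - 0))) :=
    ((hceil.const_add 5).sub (hinv.const_mul 2)).div (hinv.const_sub 8) (by norm_num)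
  convert hlim.comp (tendsto_add_atTop_nat 1) using 2 with k
  · rw [strongDensity_spinG, Function.comp_apply]
    have hk : ((k + 1 : ℕ) : ℝ) ≠ 0 := Nat.cast_ne_zero.2 k.succ_ne_zero
    field_simp
  · norm_num

end CriticalConnectivity

theorem mainTheorem1 :
    11 / 16 ≤ criticalConnectivity ∧
    (∀ (k : ℕ) [NeZero k],
      Fintype.card (ZMod 8 × ZMod k) = 8 * k ∧
      (spinG k).IsRegularOfDegree (5 * k + ⌈(k : ℝ) / 2⌉₊ - 2) ∧
      (∃ θ : ZMod 8 × ZMod k → ℝ,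
        IsLinearlyStableEquilibrium (spinG k) θ ∧ ¬ IsConsensus θ) ∧
      ¬ Synchronizes (spinG k)) ∧
    Tendsto (fun k : ℕ => strongDensity (spinG (k + 1))) atTop (𝓝 (11 / 16)) := by
  refine ⟨?_, fun k _ => ⟨?_, isRegularOfDegree_spinG k,
    exists_isLinearlyStableEquilibrium_spinG k, not_synchronizes_spinG k⟩,
    tendsto_strongDensity_spinG⟩
  · exact le_of_tendsto' tendsto_strongDensity_spinG fun k =>
      strongDensity_le_criticalConnectivity _ (not_synchronizes_spinG (k + 1))
  · rw [Fintype.card_prod, ZMod.card, ZMod.card]
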